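/- Let $m\ge 0$ and let $K$ be a simplicial complex on $[m]=\{1,\dots,m\}$, i.e. a family of subsets of $[m]$ that contains $\varnothing$ and is closed under taking subsets (not every $\{i\}$ is required to belong to $K$). Let $N(K)$ be the set of minimal non-simplices of $K$: the subsets $\omega\subseteq[m]$ with $\omega\notin K$ all of whose proper subsets belong to $K$. Let $$\mathcal Z_K=\{(z_1,\dots,z_m)\in\mathbb C^m:\ |z_i|\le 1\text{ for all } i,\ \{i: |z_i|\ne 1\}\in K\}$$ be the moment-angle complex, on which $T^m=(S^1)^m$ acts by coordinatewise multiplication. The Buchstaber invariant $s(K)$ is the maximal $s$ for which there is a subgroup $H\subseteq T^m$, isomorphic to $T^s$ as a topological group, that acts freely on $\mathcal Z_K$. Theorem. 1. $s(K)\ge 1$ if and only if $N(K)\neq\varnothing$ (equivalently, $K$ is not the full simplex $2^{[m]}$). 2. $s(K)\ge 2$ if and only if $N(K)$ contains three distinct sets $\tau_1,\tau_2,\tau_3$ with $\tau_1\cap\tau_2\cap\tau_3=\varnothing$, or two distinct sets $\tau_1,\tau_2$ with $\tau_1\cap\tau_2=\varnothing$. 3. $s(K)\ge 3$ if and only if $N(K)$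 contains one of the following configurations of pairwise distinct sets: (a) $\tau_1,\dots,\tau_7$ with $\tau_1\cap\tau_2\cap\tau_4=\tau_1\cap\tau_3\cap\tau_5=\tau_1\cap\tau_6\cap\tau_7=\tau_2\cap\tau_3\cap\tau_6=\tau_2\cap\tau_5\cap\tau_7=\tau_3\cap\tau_4\cap\tau_7=\tau_4\cap\tau_5\cap\tau_6=\varnothing$; (b) $\tau_1,\dots,\tau_6$ with $\tau_1\cap\tau_3=\tau_1\cap\tau_2\cap\tau_4=\tau_1\cap\tau_2\cap\tau_5=\tau_1\cap\tau_4\cap\tau_6=\tau_1\cap\tau_5\cap\tau_6=\tau_2\cap\tau_3\cap\tau_6=\tau_3\cap\tau_4\cap\tau_5=\varnothing$; (c) $\tau_1,\dots,\tau_5$ with $\tau_1\cap\tau_2=\tau_1\cap\tau_5=\tau_1\cap\tau_3\cap\tau_4=\tau_2\cap\tau_3\cap\tau_5=\tau_2\cap\tau_4\cap\tau_5=\varnothing$; (d) $\tau_1,\dots,\tau_4$ with $\tau_1\cap(\tau_2\cup\tau_3\cup\tau_4)=\varnothing$ and $\tau_2\cap\tau_3\cap\tau_4=\varnothing$; (e)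 $\tau_1,\tau_2,\tau_3$ with $\tau_1\cap\tau_2=\tau_1\cap\tau_3=\tau_2\cap\tau_3=\varnothing$. -/

import Mathlib

/-! A simplicial complex on the vertex set `{1, …, m}` is a `PreAbstractSimplicialComplex (Fin m)`.
Mathlib records only the nonempty faces and does not require every vertex to be a face; the empty
set, which is a simplex of every complex, is added by `BuchstaberInv.IsSimplex`. -/

namespace BuchstaberInv

/-- `σ` is a simplex of `K` (the empty set always is). -/
def IsSimplex {m : ℕ} (K : PreAbstractSimplicialComplex (Fin m)) (σ : Finset (Fin m)) : Prop :=
  σ = ∅ ∨ σ ∈ K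

/-- The set `N(K)` of minimal non-simplices: non-simplices all of whose proper subsets are
simplices. -/
def minNonSimplices {m : ℕ} (K : PreAbstractSimplicialComplex (Fin m)) :
    Set (Finset (Fin m)) :=
  {ω | ¬ IsSimplex K ω ∧ ∀ σ : Finset (Fin m), σ ⊂ ω → IsSimplex K σ}

/-- The `K`-power `(X, A)^K` of a pair of subsets `A ⊆ X` of an ambient space `E`: the points
`x ∈ X ^ m` such that `{i | x i ∉ A}` is a simplex of `K`. -/
def kPower {m : ℕ} {E : Type*} (K : PreAbstractSimplicialComplex (Fin m)) (X A : Set E) :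
    Set (Fin m → E) :=
  {x | (∀ i, x i ∈ X) ∧ ∃ σ : Finset (Fin m), IsSimplex K σ ∧ ∀ i, i ∈ σ ↔ x i ∉ A}

/-- The moment-angle complex `Z_K = (D², S¹)^K`. -/
def momentAngleComplex {m : ℕ} (K : PreAbstractSimplicialComplex (Fin m)) :
    Set (Fin m → ℂ) :=
  kPower K (Metric.closedBall (0 : ℂ) 1) (Metric.sphere (0 : ℂ) 1)

/-- The coordinatewise action of the torus `T^m` preserves `Z_K`. -/
theorem mul_mem_momentAngleComplex {m : ℕ} (K : PreAbstractSimplicialComplex (Fin m))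
    (t : Fin m → Circle) {z : Fin m → ℂ} (hz : z ∈ momentAngleComplex K) :
    (fun i => (t i : ℂ) * z i) ∈ momentAngleComplex K := by
  obtain ⟨h1, σ, hσ, h2⟩ := hz
  refine ⟨fun i => ?_, σ, hσ, fun i => ?_⟩
  · have h : ‖(t i : ℂ)‖ = 1 := Circle.norm_coe (t i)
    simpa [norm_mul, h] using h1 i
  · have h : ‖(t i : ℂ)‖ = 1 := Circle.norm_coe (t i)
    simpa [norm_mul, h] using h2 i

/-- The canonical coordinatewise action of the torus `T^m` on `Z_K`. -/
noncomputable instance torusAction {m : ℕ} (K : PreAbstractSimplicialComplex (Fin m)) :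
    MulAction (Fin m → Circle) (momentAngleComplex K) where
  smul t z := ⟨fun i => (t i : ℂ) * z.1 i, mul_mem_momentAngleComplex K t z.2⟩
  one_smul z := Subtype.ext (funext fun i => by
    change ((1 : Circle) : ℂ) * z.1 i = z.1 i
    simp)
  mul_smul s t z := Subtype.ext (funext fun i => by
    change ((s i * t i : Circle) : ℂ) * z.1 i = (s i : ℂ) * ((t i : ℂ) * z.1 i)
    simp [mul_assoc])

/-- The subgroup `H` of `T^m` acts freely on `Z_K`. -/
def ActsFreely {m : ℕ} (K : PreAbstractSimplicialComplex (Fin m))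
    (H : Subgroup (Fin m → Circle)) : Prop :=
  ∀ t ∈ H, ∀ z : momentAngleComplex K, t • z = z → t = 1

/-- The dimensions `s` of the toric subgroups `H ≃ T^s` of `T^m` that act freely on `Z_K`; the
isomorphism is one of topological groups. -/
def freeToricDims {m : ℕ} (K : PreAbstractSimplicialComplex (Fin m)) : Set ℕ :=
  {s | ∃ H : Subgroup (Fin m → Circle), Nonempty (H ≃ₜ* (Fin s → Circle)) ∧ ActsFreely K H}

/-- The Buchstaber invariant `s(K)`: the maximal dimension of a toric subgroup of `T^m` that acts
freely on `Z_K`. -/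
noncomputable def buchstaberInvariant {m : ℕ} (K : PreAbstractSimplicialComplex (Fin m)) : ℕ :=
  sSup (freeToricDims K)

theorem le_of_toric {m s : ℕ} (H : Subgroup (Fin m → Circle)) (e : H ≃* (Fin s → Circle)) :
    s ≤ m := by
  classical
  let v : (Fin s → Bool) → (Fin s → Circle) := fun b i => if b i then -1 else 1
  have hne : (-1 : Circle) ≠ 1 := by
    intro h
    have h2 := congrArg (fun c : Circle => (c : ℂ)) h
    norm_num at h2
  have hv : ∀ b, v b * v b = 1 := by
    intro b
    funext i
    by_cases h : b i <;> simp [v, h]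
  have hinj : Function.Injective v := by
    intro a b hab
    funext i
    have hi := congrFun hab i
    cases ha : a i <;> cases hb : b i <;> simp [v, ha, hb, hne, hne.symm] at hi ⊢
  have hw : ∀ b i, (e.symm (v b)).1 i = 1 ∨ (e.symm (v b)).1 i = -1 := by
    intro b i
    have h1 : e.symm (v b) * e.symm (v b) = 1 := by rw [← map_mul, hv, map_one]
    have h2 : (e.symm (v b)).1 i * (e.symm (v b)).1 i = 1 :=
      congrFun (congrArg Subtype.val h1) i
    have h3 : (((e.symm (v b)).1 i : Circle) : ℂ) * (((e.symm (v b)).1 i : Circle) : ℂ) = 1 := by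
      rw [← Circle.coe_mul, h2, Circle.coe_one]
    rcases mul_self_eq_one_iff.mp h3 with h | h
    · exact Or.inl (Circle.ext (by simpa using h))
    · exact Or.inr (Circle.ext (by simpa using h))
  let f : (Fin s → Bool) → (Fin m → Bool) := fun b i => decide ((e.symm (v b)).1 i = 1)
  have hf : Function.Injective f := by
    intro a b hab
    apply hinj
    apply e.symm.injective
    apply Subtype.ext
    funext i
    have hi : ((e.symm (v a)).1 i = 1) ↔ ((e.symm (v b)).1 i = 1) := by
      simpa [f] using congrFun hab i
    rcases hw a i with h | h <;> rcases hw b i with h' | h'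
    · rw [h, h']
    · exact absurd (h'.symm.trans (hi.mp h)) hne
    · exact absurd (h.symm.trans (hi.mpr h')) hne
    · rw [h, h']
  have hcard := Fintype.card_le_of_injective f hf
  simp only [Fintype.card_fun, Fintype.card_bool, Fintype.card_fin] at hcard
  exact (Nat.pow_le_pow_iff_right (by norm_num)).mp hcard

/-- The maximum in the definition of `s(K)` exists. -/
theorem isGreatest_buchstaberInvariant {m : ℕ} (K : PreAbstractSimplicialComplex (Fin m)) :
    IsGreatest (freeToricDims K) (buchstaberInvariant K) := by
  have hb : BddAbove (freeToricDims K) :=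
    ⟨m, fun s ⟨H, ⟨e⟩, _⟩ => le_of_toric H e.toMulEquiv⟩
  have hn : (freeToricDims K).Nonempty := by
    refine ⟨0, ⊥, ⟨?_⟩, ?_⟩
    · exact
        { toFun := fun _ => 1
          invFun := fun _ => 1
          left_inv := fun _ => Subsingleton.elim _ _
          right_inv := fun _ => Subsingleton.elim _ _
          map_mul' := fun _ _ => Subsingleton.elim _ _
          continuous_toFun := continuous_const
          continuous_invFun := continuous_const }
    · intro t ht _ _
      exact Subgroup.mem_bot.mp ht
  exact ⟨Nat.sSup_mem hn hb, fun s hs => le_csSup hb hs⟩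

/-- The family `N` contains the subset whose (pairwise distinct) members are listed in `l`. -/
def ContainsDistinct {α : Type*} (N : Set α) (l : List α) : Prop :=
  l.Nodup ∧ ∀ τ ∈ l, τ ∈ N

/-- Condition (S1). -/
def ConditionS1 {α : Type*} (N : Set (Finset α)) : Prop :=
  N.Nonempty

/-- Condition (S2). -/
def ConditionS2 {α : Type*} [DecidableEq α] (N : Set (Finset α)) : Prop :=
  (∃ τ₁ τ₂ τ₃ : Finset α, ContainsDistinct N [τ₁, τ₂, τ₃] ∧ τ₁ ∩ τ₂ ∩ τ₃ = ∅) ∨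
  (∃ τ₁ τ₂ : Finset α, ContainsDistinct N [τ₁, τ₂] ∧ τ₁ ∩ τ₂ = ∅)

/-- Condition (S3). -/
def ConditionS3 {α : Type*} [DecidableEq α] (N : Set (Finset α)) : Prop :=
  (∃ τ₁ τ₂ τ₃ τ₄ τ₅ τ₆ τ₇ : Finset α, ContainsDistinct N [τ₁, τ₂, τ₃, τ₄, τ₅, τ₆, τ₇] ∧
    τ₁ ∩ τ₂ ∩ τ₄ = ∅ ∧ τ₁ ∩ τ₃ ∩ τ₅ = ∅ ∧ τ₁ ∩ τ₆ ∩ τ₇ = ∅ ∧ τ₂ ∩ τ₃ ∩ τ₆ = ∅ ∧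
    τ₂ ∩ τ₅ ∩ τ₇ = ∅ ∧ τ₃ ∩ τ₄ ∩ τ₇ = ∅ ∧ τ₄ ∩ τ₅ ∩ τ₆ = ∅) ∨
  (∃ τ₁ τ₂ τ₃ τ₄ τ₅ τ₆ : Finset α, ContainsDistinct N [τ₁, τ₂, τ₃, τ₄, τ₅, τ₆] ∧
    τ₁ ∩ τ₃ = ∅ ∧ τ₁ ∩ τ₂ ∩ τ₄ = ∅ ∧ τ₁ ∩ τ₂ ∩ τ₅ = ∅ ∧ τ₁ ∩ τ₄ ∩ τ₆ = ∅ ∧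
    τ₁ ∩ τ₅ ∩ τ₆ = ∅ ∧ τ₂ ∩ τ₃ ∩ τ₆ = ∅ ∧ τ₃ ∩ τ₄ ∩ τ₅ = ∅) ∨
  (∃ τ₁ τ₂ τ₃ τ₄ τ₅ : Finset α, ContainsDistinct N [τ₁, τ₂, τ₃, τ₄, τ₅] ∧
    τ₁ ∩ τ₂ = ∅ ∧ τ₁ ∩ τ₅ = ∅ ∧ τ₁ ∩ τ₃ ∩ τ₄ = ∅ ∧ τ₂ ∩ τ₃ ∩ τ₅ = ∅ ∧
    τ₂ ∩ τ₄ ∩ τ₅ = ∅) ∨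
  (∃ τ₁ τ₂ τ₃ τ₄ : Finset α, ContainsDistinct N [τ₁, τ₂, τ₃, τ₄] ∧
    τ₁ ∩ (τ₂ ∪ τ₃ ∪ τ₄) = ∅ ∧ τ₂ ∩ τ₃ ∩ τ₄ = ∅) ∨
  (∃ τ₁ τ₂ τ₃ : Finset α, ContainsDistinct N [τ₁, τ₂, τ₃] ∧
    τ₁ ∩ τ₂ = ∅ ∧ τ₁ ∩ τ₃ = ∅ ∧ τ₂ ∩ τ₃ = ∅)

end BuchstaberInv

namespace BuchstaberInv

/-! ### Collisions in the Fano plane and the configurations (a)–(e). -/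

section Configurations

variable {α : Type*} [DecidableEq α] {N : Set (Finset α)}

/-! For s = 2, 3 both directions pass through families of minimal non-simplices `F u`, indexed by
the nonzero `u` in F₂ˢ and possibly with repetitions, whose intersection along every line `{u, v, u
+ v}` is empty.

A freely acting torus gives such a family (`exists_nonSimplices_of_le`). Stabilizers are the
coordinate tori of simplices, so the support of each element of order two is a non-simplex and
contains a minimal one. A coordinate equal to `-1` in two elements is `1` in their product.

Conversely, the indices `u` of the sets containing a vertex `i` include no line, so some functional
`a i` equals 1 on all of them. Its 0/1 values are the exponents of the map `torusHom`. For a simplex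
σ, each `F u` has a vertex `i` outside σ, and the monomial of row `a i` pairs oddly with `u`. If all
monomials outside σ are trivial at `t`, their exponents span F₂ˢ; a 0/1 determinant of size at most
3 that is odd is ±1, so `t = 1`.

The lists in (S2) and (S3) record the possible coincidences in such a family. -/

theorem ne_of_inter_eq_empty (hN : ∅ ∉ N) {X Y : Finset α} (hX : X ∈ N) (h : X ∩ Y = ∅) :
    X ≠ Y := by
  rintro rfl
  rw [Finset.inter_self] at h
  exact hN (h ▸ hX)

/-- The plane with `A` at the four points off a line and `B`, `C`, `D` on that line: (d), or (e) if
two of the three coincide. -/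
theorem conditionS3_of_four (hN : ∅ ∉ N) {A B C D : Finset α}
    (hA : A ∈ N) (hB : B ∈ N) (hC : C ∈ N) (hD : D ∈ N)
    (hAB : A ∩ B = ∅) (hAC : A ∩ C = ∅) (hAD : A ∩ D = ∅) (hBCD : B ∩ C ∩ D = ∅) :
    ConditionS3 N := by
  have ne : ∀ {X Y : Finset α}, X ∈ N → X ∩ Y = ∅ → X ≠ Y := ne_of_inter_eq_empty hN
  have three : ∀ {X Y : Finset α}, X ∈ N → Y ∈ N → A ∩ X = ∅ → A ∩ Y = ∅ → X ∩ Y = ∅ →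
      ConditionS3 N := by
    intro X Y hX hY hAX hAY hXY
    refine Or.inr (Or.inr (Or.inr (Or.inr ⟨A, X, Y, ⟨?_, ?_⟩, hAX, hAY, hXY⟩)))
    · simp [ne hA hAX, ne hA hAY, ne hX hXY]
    · simp [hA, hX, hY]
  by_cases h1 : B = C
  · subst h1; exact three hB hD hAB hAD (by grind)
  by_cases h2 : B = D
  · subst h2; exact three hB hC hAB hAC (by grind)
  by_cases h3 : C = D
  · subst h3; exact three hB hC hAB hAC (by grind)
  refine Or.inr (Or.inr (Or.inr (Or.inl ⟨A, B, C, D, ⟨?_, ?_⟩, by grind, hBCD⟩)))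
  · simp [ne hA hAB, ne hA hAC, ne hA hAD, h1, h2, h3]
  · simp [hA, hB, hC, hD]

/-- The three lines through the point of `T` carry the further pairs `A, A`, `B, B` and `X, Y`. This
is (c), and any coincidence reduces it to the four-set case. -/
theorem conditionS3_of_five (hN : ∅ ∉ N) {T A B X Y : Finset α}
    (hT : T ∈ N) (hA : A ∈ N) (hB : B ∈ N) (hX : X ∈ N) (hY : Y ∈ N)
    (hTA : T ∩ A = ∅) (hTB : T ∩ B = ∅) (hTXY : T ∩ X ∩ Y = ∅)
    (hABX : A ∩ B ∩ X = ∅) (hABY : A ∩ B ∩ Y = ∅) :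
    ConditionS3 N := by
  have h1 : T ≠ A := ne_of_inter_eq_empty hN hT hTA
  have h2 : T ≠ B := ne_of_inter_eq_empty hN hT hTB
  by_cases h3 : A = B
  · exact conditionS3_of_four hN hA hT hX hY (by grind) (by grind) (by grind) (by grind)
  by_cases h4 : T = X
  · exact conditionS3_of_four hN hT hA hB hY (by grind) (by grind) (by grind) (by grind)
  by_cases h5 : T = Y
  · exact conditionS3_of_four hN hT hA hB hX (by grind) (by grind) (by grind) (by grind)
  by_cases h6 : X = Y
  · exact conditionS3_of_four hN hT hA hB hX (by grind) (by grind) (by grind) (by grind)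
  by_cases h7 : A = X
  · exact conditionS3_of_four hN hT hA hB hA (by grind) (by grind) (by grind) (by grind)
  by_cases h8 : A = Y
  · exact conditionS3_of_four hN hT hA hB hA (by grind) (by grind) (by grind) (by grind)
  by_cases h9 : B = X
  · exact conditionS3_of_four hN hT hA hB hA (by grind) (by grind) (by grind) (by grind)
  by_cases h10 : B = Y
  · exact conditionS3_of_four hN hT hA hB hA (by grind) (by grind) (by grind) (by grind)
  refine Or.inr (Or.inr (Or.inl ⟨T, A, X, Y, B, ⟨?_, ?_⟩, hTA, hTB, hTXY, by grind, by grind⟩))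
  · simp [*, Ne.symm h9, Ne.symm h10]
  · simp [*]

/-- One collision: `A` sits at two points of a line and `T` at the third. The other four points form
a cycle `P, Q, R, S` whose sides meet the points of `A` and whose diagonals meet that of `T`. This
is (b) unless there is a further coincidence. -/
theorem conditionS3_of_six (hN : ∅ ∉ N) {A T P Q R S : Finset α}
    (hA : A ∈ N) (hT : T ∈ N) (hP : P ∈ N) (hQ : Q ∈ N) (hR : R ∈ N) (hS : S ∈ N)
    (hAT : A ∩ T = ∅) (hAPQ : A ∩ P ∩ Q = ∅) (hAQR : A ∩ Q ∩ R = ∅) (hARS : A ∩ R ∩ S = ∅)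
    (hAPS : A ∩ P ∩ S = ∅) (hTPR : T ∩ P ∩ R = ∅) (hTQS : T ∩ Q ∩ S = ∅) :
    ConditionS3 N := by
  have h0 : A ≠ T := ne_of_inter_eq_empty hN hA hAT
  by_cases h1 : A = P
  · exact conditionS3_of_four hN hA hT hQ hS (by grind) (by grind) (by grind) (by grind)
  by_cases h2 : A = Q
  · exact conditionS3_of_four hN hA hT hP hR (by grind) (by grind) (by grind) (by grind)
  by_cases h3 : A = R
  · exact conditionS3_of_four hN hA hT hQ hS (by grind) (by grind) (by grind) (by grind)
  by_cases h4 : A = S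
  · exact conditionS3_of_four hN hA hT hP hR (by grind) (by grind) (by grind) (by grind)
  by_cases h5 : T = P
  · exact conditionS3_of_five hN hT hA hR hQ hS (by grind) (by grind) (by grind) (by grind)
      (by grind)
  by_cases h6 : T = Q
  · exact conditionS3_of_five hN hT hA hS hP hR (by grind) (by grind) (by grind) (by grind)
      (by grind)
  by_cases h7 : T = R
  · exact conditionS3_of_five hN hT hA hP hQ hS (by grind) (by grind) (by grind) (by grind)
      (by grind)
  by_cases h8 : T = S
  · exact conditionS3_of_five hN hT hA hQ hP hR (by grind) (by grind) (by grind) (by grind)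
      (by grind)
  by_cases h9 : P = Q
  · exact conditionS3_of_five hN hA hT hP hR hS (by grind) (by grind) (by grind) (by grind)
      (by grind)
  by_cases h10 : Q = R
  · exact conditionS3_of_five hN hA hT hQ hS hP (by grind) (by grind) (by grind) (by grind)
      (by grind)
  by_cases h11 : R = S
  · exact conditionS3_of_five hN hA hT hR hP hQ (by grind) (by grind) (by grind) (by grind)
      (by grind)
  by_cases h12 : P = S
  · exact conditionS3_of_five hN hA hT hS hQ hR (by grind) (by grind) (by grind) (by grind)
      (by grind)
  by_cases h13 : P = R
  · exact conditionS3_of_five hN hT hA hP hQ hS (by grind) (by grind) (by grind) (by grind)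
      (by grind)
  by_cases h14 : Q = S
  · exact conditionS3_of_five hN hT hA hQ hP hR (by grind) (by grind) (by grind) (by grind)
      (by grind)
  refine Or.inr (Or.inl ⟨A, P, T, Q, S, R, ⟨?_, ?_⟩, hAT, hAPQ, hAPS, hAQR, by grind, by grind,
    by grind⟩)
  · simp [*, Ne.symm h5, Ne.symm h11]
  · simp [*]

/-- A family indexed by the nonzero vectors of `F₂³` whose members along each line of the Fano
plane have empty intersection yields one of the configurations of `ConditionS3`. -/
theorem conditionS3_of_fano (hN : ∅ ∉ N) (F : (Fin 3 → ZMod 2) → Finset α)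
    (hF : ∀ u, u ≠ 0 → F u ∈ N)
    (hline : ∀ u v, u ≠ 0 → v ≠ 0 → u ≠ v → F u ∩ F v ∩ F (u + v) = ∅) :
    ConditionS3 N := by
  by_cases hinj : ∃ u v, u ≠ 0 ∧ v ≠ 0 ∧ u ≠ v ∧ F u = F v
  · obtain ⟨u, v, hu, hv, huv, heq⟩ := hinj
    -- With `w` off the line of `u` and `v`, the four points off that line are `w`, `w + u`, `w +
    -- v`, `w + (u + v)`.
    obtain ⟨w, hw0, hwu, hwv, hwuv⟩ :
        ∃ w : Fin 3 → ZMod 2, w ≠ 0 ∧ w ≠ u ∧ w ≠ v ∧ w ≠ u + v := by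
      clear heq hu hv huv
      revert u v; decide
    have two : ∀ x : Fin 3 → ZMod 2, x + x = 0 := by decide
    have line : ∀ x y z : Fin 3 → ZMod 2, x ≠ 0 → y ≠ 0 → x ≠ y → x + y = z →
        F x ∩ F y ∩ F z = ∅ := fun x y z hx hy hxy h => h ▸ hline x y hx hy hxy
    have add_ne : ∀ {x y : Fin 3 → ZMod 2}, x ≠ y → x + y ≠ 0 := by decide
    have h3 : w + (u + v) ≠ 0 := add_ne hwuv
    have e1 : u + (w + u) = w := by rw [add_left_comm, two, add_zero]
    have e2 : v + (w + v) = w := by rw [add_left_comm, two, add_zero]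
    have e3 : u + (w + (u + v)) = w + v := by
      rw [add_left_comm, ← add_assoc u u v, two, zero_add]
    have e4 : v + (w + (u + v)) = w + u := by
      rw [add_left_comm, add_left_comm v u v, two, add_zero]
    have e5 : (w + u) + (w + v) = u + v := by
      rw [add_add_add_comm, two, zero_add]
    refine conditionS3_of_six hN (A := F u) (T := F (u + v)) (P := F w) (Q := F (w + u))
      (R := F (w + (u + v))) (S := F (w + v)) (hF _ hu) (hF _ (add_ne huv)) (hF _ hw0)
      (hF _ (add_ne hwu)) (hF _ h3) (hF _ (add_ne hwv)) ?_ ?_ ?_ ?_ ?_ ?_ ?_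
    · have := hline u v hu hv huv
      rwa [← heq, Finset.inter_self] at this
    · have := hline w u hw0 hu hwu
      grind
    · have := line v (w + (u + v)) _ hv h3 (by grind) e4
      grind
    · have := line u (w + (u + v)) _ hu h3 (by grind) e3
      grind
    · have := hline w v hw0 hv hwv
      grind
    · have := hline w (u + v) hw0 (add_ne huv) hwuv
      grind
    · have := line (w + u) (w + v) _ (add_ne hwu) (add_ne hwv) (by grind) e5
      grind
  · push Not at hinj
    refine Or.inl ⟨F ![1, 0, 0], F ![0, 1, 0], F ![0, 0, 1], F ![1, 1, 0], F ![1, 0, 1],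
      F ![0, 1, 1], F ![1, 1, 1], ⟨?_, ?_⟩, ?_⟩
    · simp only [List.nodup_cons, List.mem_cons, List.not_mem_nil, or_false, not_or]
      refine ⟨⟨?_, ?_, ?_, ?_, ?_, ?_⟩, ⟨?_, ?_, ?_, ?_, ?_⟩, ⟨?_, ?_, ?_, ?_⟩, ⟨?_, ?_, ?_⟩,
        ⟨?_, ?_⟩, ?_, not_false, List.nodup_nil⟩ <;>
      exact hinj _ _ (by decide) (by decide) (by decide)
    · simp only [List.forall_mem_cons, List.not_mem_nil, false_imp_iff, implies_true, and_true]
      refine ⟨?_, ?_, ?_, ?_, ?_, ?_, ?_⟩ <;> exact hF _ (by decide)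
    · have line : ∀ x y z : Fin 3 → ZMod 2, x ≠ 0 ∧ y ≠ 0 ∧ x ≠ y ∧ x + y = z →
        F x ∩ F y ∩ F z = ∅ := fun x y z ⟨hx, hy, hxy, h⟩ => h ▸ hline x y hx hy hxy
      refine ⟨?_, ?_, ?_, ?_, ?_, ?_, ?_⟩ <;> exact line _ _ _ (by decide)

/-- The collisions are undone by repeating sets. Indices 1, …, 7 stand for 100, 010, 001, 110, 101,
011, 111. -/
theorem exists_fano_of_conditionS3 (h : ConditionS3 N) :
    ∃ τ₁ τ₂ τ₃ τ₄ τ₅ τ₆ τ₇ : Finset α, (∀ τ ∈ [τ₁, τ₂, τ₃, τ₄, τ₅, τ₆, τ₇], τ ∈ N) ∧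
      τ₁ ∩ τ₂ ∩ τ₄ = ∅ ∧ τ₁ ∩ τ₃ ∩ τ₅ = ∅ ∧ τ₁ ∩ τ₆ ∩ τ₇ = ∅ ∧ τ₂ ∩ τ₃ ∩ τ₆ = ∅ ∧
      τ₂ ∩ τ₅ ∩ τ₇ = ∅ ∧ τ₃ ∩ τ₄ ∩ τ₇ = ∅ ∧ τ₄ ∩ τ₅ ∩ τ₆ = ∅ := by
  obtain h | h | h | h | h := h
  · obtain ⟨a, b, c, d, e, f, g, ⟨-, hN⟩, h⟩ := h
    exact ⟨a, b, c, d, e, f, g, hN, h⟩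
  · obtain ⟨a, b, c, d, e, f, ⟨-, hN⟩, h⟩ := h
    refine ⟨a, a, b, c, d, e, f, by simp at hN ⊢; tauto, ?_⟩
    refine ⟨?_, ?_, ?_, ?_, ?_, ?_, ?_⟩ <;> grind
  · obtain ⟨a, b, c, d, e, ⟨-, hN⟩, h⟩ := h
    refine ⟨b, b, e, a, c, d, e, by simp at hN ⊢; tauto, ?_⟩
    refine ⟨?_, ?_, ?_, ?_, ?_, ?_, ?_⟩ <;> grind
  · obtain ⟨a, b, c, d, ⟨-, hN⟩, h⟩ := h
    refine ⟨a, a, a, b, c, d, a, by simp at hN ⊢; tauto, ?_⟩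
    refine ⟨?_, ?_, ?_, ?_, ?_, ?_, ?_⟩ <;> grind
  · obtain ⟨a, b, c, ⟨-, hN⟩, h⟩ := h
    refine ⟨a, a, a, b, c, b, a, by simp at hN ⊢; tauto, ?_⟩
    refine ⟨?_, ?_, ?_, ?_, ?_, ?_, ?_⟩ <;> grind

theorem conditionS2_of_line (hN : ∅ ∉ N) {A B C : Finset α} (hA : A ∈ N) (hB : B ∈ N)
    (hC : C ∈ N) (h : A ∩ B ∩ C = ∅) : ConditionS2 N := by
  have two : ∀ {X Y : Finset α}, X ∈ N → Y ∈ N → X ∩ Y = ∅ → ConditionS2 N := by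
    intro X Y hX hY hXY
    refine Or.inr ⟨X, Y, ⟨?_, ?_⟩, hXY⟩
    · simp [ne_of_inter_eq_empty hN hX hXY]
    · simp [hX, hY]
  by_cases h1 : A = B
  · exact two hA hC (by grind)
  by_cases h2 : A = C
  · exact two hA hB (by grind)
  by_cases h3 : B = C
  · exact two hA hB (by grind)
  exact Or.inl ⟨A, B, C, ⟨by simp [*], by simp [*]⟩, h⟩

theorem exists_line_of_conditionS2 (h : ConditionS2 N) :
    ∃ A ∈ N, ∃ B ∈ N, ∃ C ∈ N, A ∩ B ∩ C = ∅ := by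
  obtain ⟨a, b, c, ⟨-, hN⟩, h⟩ | ⟨a, b, ⟨-, hN⟩, h⟩ := h
  · exact ⟨a, hN a (by simp), b, hN b (by simp), c, hN c (by simp), h⟩
  · exact ⟨a, hN a (by simp), b, hN b (by simp), a, hN a (by simp), by grind⟩

end Configurations

/-! ### Simplices and minimal non-simplices. -/

section Simplices

variable {m : ℕ} {K : PreAbstractSimplicialComplex (Fin m)}

theorem isSimplex_empty : IsSimplex K ∅ := Or.inl rfl

theorem IsSimplex.mono {σ τ : Finset (Fin m)} (hσ : IsSimplex K σ) (h : τ ⊆ σ) :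
    IsSimplex K τ := by
  rcases τ.eq_empty_or_nonempty with rfl | hτ
  · exact isSimplex_empty
  rcases hσ with rfl | hσ
  · exact absurd (Finset.subset_empty.mp h) hτ.ne_empty
  · exact Or.inr ((K.isRelLowerSet_faces hσ).2 h hτ)

theorem empty_notMem_minNonSimplices : ∅ ∉ minNonSimplices K := fun h => h.1 isSimplex_empty

theorem exists_subset_mem_minNonSimplices (ω : Finset (Fin m)) (hω : ¬ IsSimplex K ω) :
    ∃ τ ⊆ ω, τ ∈ minNonSimplices K := by
  induction ω using Finset.strongInduction with
  | H ω ih =>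
    by_cases h : ∀ σ, σ ⊂ ω → IsSimplex K σ
    · exact ⟨ω, subset_rfl, hω, h⟩
    · push Not at h
      obtain ⟨σ, hσω, hσ⟩ := h
      obtain ⟨τ, hτ, hN⟩ := ih σ hσω hσ
      exact ⟨τ, hτ.trans hσω.subset, hN⟩

theorem conditionS1_iff :
    ConditionS1 (minNonSimplices K) ↔ ¬ ∀ σ : Finset (Fin m), IsSimplex K σ := by
  constructor
  · rintro ⟨τ, hτ⟩ h
    exact hτ.1 (h τ)
  · intro h
    push Not at h
    obtain ⟨ω, hω⟩ := h
    obtain ⟨τ, -, hτ⟩ := exists_subset_mem_minNonSimplices ω hω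
    exact ⟨τ, hτ⟩

/-- A minimal non-simplex is not contained in a simplex. -/
theorem exists_mem_notMem_of_mem_minNonSimplices {τ σ : Finset (Fin m)}
    (hτ : τ ∈ minNonSimplices K) (hσ : IsSimplex K σ) : ∃ i ∈ τ, i ∉ σ :=
  Finset.not_subset.mp fun h => hτ.1 (hσ.mono h)

end Simplices

/-! ### Free actions and tori given by 0/1 matrices. -/

section Freeness

variable {m : ℕ} {K : PreAbstractSimplicialComplex (Fin m)}

/-- The stabilizers of the points of `Z_K` are the coordinate subtori of the simplices. -/
theorem actsFreely_iff {H : Subgroup (Fin m → Circle)} :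
    ActsFreely K H ↔
      ∀ t ∈ H, ∀ σ : Finset (Fin m), IsSimplex K σ → (∀ i, i ∉ σ → t i = 1) → t = 1 := by
  constructor
  · intro h t ht σ hσ hone
    -- The stabilizer of this point is the whole coordinate torus of `σ`.
    let z : Fin m → ℂ := fun i => if i ∈ σ then 0 else 1
    have hz : z ∈ momentAngleComplex K := by
      refine ⟨fun i => ?_, σ, hσ, fun i => ?_⟩ <;> by_cases hi : i ∈ σ <;> simp [z, hi]
    refine h t ht ⟨z, hz⟩ (Subtype.ext (funext fun i => ?_))
    change (t i : ℂ) * z i = z i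
    by_cases hi : i ∈ σ
    · simp [z, hi]
    · rw [hone i hi, Circle.coe_one, one_mul]
  · rintro h t ht ⟨z, hz⟩ hfix
    have h2 : ∀ i, (t i : ℂ) * z i = z i := fun i => congrFun (congrArg Subtype.val hfix) i
    obtain ⟨-, σ, hσ, hi⟩ := hz
    refine h t ht σ hσ fun i hiσ => ?_
    have h1 : ‖z i‖ = 1 := by
      have : z i ∈ Metric.sphere (0 : ℂ) 1 := by
        by_contra hc
        exact hiσ ((hi i).mpr hc)
      simpa using this
    have h3 : z i ≠ 0 := by
      intro h0
      simp [h0] at h1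
    exact Circle.ext (by simpa using mul_right_cancel₀ h3 ((h2 i).trans (one_mul _).symm))

/-- The homomorphism `T^s → T^m` given by a matrix with entries `0` and `1`. -/
noncomputable def torusHom {s : ℕ} (a : Fin m → Fin s → Bool) :
    (Fin s → Circle) →* (Fin m → Circle) where
  toFun t i := ∏ j, if a i j then t j else 1
  map_one' := by
    funext i
    simp
  map_mul' t u := by
    funext i
    simp only [Pi.mul_apply, ← Finset.prod_mul_distrib]
    refine Finset.prod_congr rfl fun j _ => ?_
    split_ifs <;> simp

theorem torusHom_apply {s : ℕ} (a : Fin m → Fin s → Bool) (t : Fin s → Circle) (i : Fin m) :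
    torusHom a t i = ∏ j, if a i j then t j else 1 := rfl

theorem continuous_torusHom {s : ℕ} (a : Fin m → Fin s → Bool) : Continuous (torusHom a) := by
  refine continuous_pi fun i => ?_
  simp only [torusHom_apply]
  refine continuous_finsetProd _ fun j _ => ?_
  split_ifs
  · exact continuous_apply j
  · exact continuous_const

/-- The simplex `∅` already forces injectivity, and compactness of the torus makes the bijection
onto the image a homeomorphism. -/
theorem mem_freeToricDims_of_torusHom {s : ℕ} (a : Fin m → Fin s → Bool)
    (h : ∀ σ : Finset (Fin m), IsSimplex K σ → ∀ t : Fin s → Circle,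
      (∀ i, i ∉ σ → torusHom a t i = 1) → t = 1) : s ∈ freeToricDims K := by
  have hinj : Function.Injective (torusHom a) := by
    rw [injective_iff_map_eq_one]
    intro t ht
    exact h ∅ isSimplex_empty t fun i _ => congrFun ht i
  let e : (Fin s → Circle) ≃* (torusHom a).range := MonoidHom.ofInjective hinj
  have he : Continuous e := (continuous_torusHom a).subtype_mk _
  let e' : (Fin s → Circle) ≃ₜ* (torusHom a).range :=
    { e with
      continuous_toFun := he
      continuous_invFun := (he.homeoOfEquivCompactToT2 (f := e.toEquiv)).continuous_symm }
  refine ⟨(torusHom a).range, ⟨e'.symm⟩, actsFreely_iff.mpr ?_⟩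
  rintro _ ⟨t, rfl⟩ σ hσ hfix
  rw [h σ hσ t hfix, map_one]

theorem le_buchstaberInvariant_of_torusHom {s : ℕ} (a : Fin m → Fin s → Bool)
    (h : ∀ σ : Finset (Fin m), IsSimplex K σ → ∀ t : Fin s → Circle,
      (∀ i, i ∉ σ → torusHom a t i = 1) → t = 1) : s ≤ buchstaberInvariant K :=
  (isGreatest_buchstaberInvariant K).2 (mem_freeToricDims_of_torusHom a h)

/-! ### Elements of order two in a freely acting torus. -/

/-- The element of order two of `T^n` with exponents `u`, padded by ones. -/
noncomputable def signVec {s : ℕ} (n : ℕ) (u : Fin s → ZMod 2) : Fin n → Circle := fun j =>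
  if h : (j : ℕ) < s then (if u ⟨j, h⟩ = 0 then 1 else -1) else 1

theorem circle_neg_one_ne_one : (-1 : Circle) ≠ 1 := by
  intro h
  have h2 := congrArg (fun c : Circle => (c : ℂ)) h
  norm_num at h2

theorem signVec_add {s n : ℕ} (u v : Fin s → ZMod 2) :
    signVec n (u + v) = signVec n u * signVec n v := by
  have h2 : ∀ x : ZMod 2, x = 0 ∨ x = 1 := by decide
  have h11 : (1 + 1 : ZMod 2) = 0 := by decide
  funext j
  simp only [signVec, Pi.mul_apply, Pi.add_apply]
  by_cases h : (j : ℕ) < s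
  · rcases h2 (u ⟨j, h⟩) with hu | hu <;> rcases h2 (v ⟨j, h⟩) with hv | hv <;>
      simp [h, hu, hv, h11]
  · simp [h]

theorem signVec_ne_one {s n : ℕ} (hs : s ≤ n) {u : Fin s → ZMod 2} (hu : u ≠ 0) :
    signVec n u ≠ 1 := by
  intro h
  apply hu
  funext j
  have hj := congrFun h ⟨j, j.2.trans_le hs⟩
  by_contra hc
  have hc' : u j ≠ 0 := hc
  simp [signVec, hc', circle_neg_one_ne_one] at hj

/-- The elements of order two of a freely acting torus provide non-simplices, indexed by the
nonzero vectors over `F₂`, with empty intersections along lines. -/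
theorem exists_nonSimplices_of_le {s : ℕ} (hs : s ≤ buchstaberInvariant K) :
    ∃ F : (Fin s → ZMod 2) → Finset (Fin m), (∀ u, u ≠ 0 → F u ∈ minNonSimplices K) ∧
      ∀ u v, u ≠ 0 → v ≠ 0 → u ≠ v → F u ∩ F v ∩ F (u + v) = ∅ := by
  classical
  obtain ⟨H, ⟨e⟩, hfree⟩ := (isGreatest_buchstaberInvariant K).1
  rw [actsFreely_iff] at hfree
  let w : (Fin s → ZMod 2) → Fin m → Circle := fun u => (e.symm (signVec _ u)).1
  have hadd : ∀ u v, w (u + v) = w u * w v := fun u v => by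
    simp only [w, signVec_add, map_mul, Subgroup.coe_mul]
  have hw1 : ∀ u, u ≠ 0 → w u ≠ 1 := by
    intro u hu h
    refine signVec_ne_one hs hu (e.symm.injective (Subtype.ext ?_))
    rw [map_one]
    exact h
  have two : ∀ x : ZMod 2, x + x = 0 := by decide
  have hw : ∀ u i, w u i = 1 ∨ w u i = -1 := by
    intro u i
    have h0 : w 0 = 1 := by
      have := hadd 0 0
      rw [add_zero] at this
      exact left_eq_mul.mp this
    have h1 : w u i * w u i = 1 := by
      rw [← Pi.mul_apply, ← hadd, show u + u = 0 from funext fun j => two _, h0, Pi.one_apply]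
    have h3 : ((w u i : Circle) : ℂ) * ((w u i : Circle) : ℂ) = 1 := by
      rw [← Circle.coe_mul, h1, Circle.coe_one]
    rcases mul_self_eq_one_iff.mp h3 with h | h
    · exact Or.inl (Circle.ext (by simpa using h))
    · exact Or.inr (Circle.ext (by simpa using h))
  let ω : (Fin s → ZMod 2) → Finset (Fin m) := fun u => {i | w u i ≠ 1}
  have hω : ∀ u, u ≠ 0 → ∃ τ ⊆ ω u, τ ∈ minNonSimplices K := fun u hu => by
    refine exists_subset_mem_minNonSimplices _ fun hσ => hw1 u hu ?_
    exact hfree _ (e.symm (signVec _ u)).2 (ω u) hσ fun i hi => by simpa [ω] using hi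
  choose! F hF hFN using hω
  refine ⟨F, hFN, fun u v hu hv huv => ?_⟩
  have huv0 : u + v ≠ 0 := by
    intro h
    refine huv (funext fun j => ?_)
    have hj : u j + v j = 0 := congrFun h j
    generalize u j = x at *
    generalize v j = y at *
    revert x y
    decide
  rw [Finset.eq_empty_iff_forall_notMem]
  intro i hi
  simp only [Finset.mem_inter] at hi
  obtain ⟨⟨h1, h2⟩, h3⟩ := hi
  have h1 := hF u hu h1
  have h2 := hF v hv h2
  have h3 := hF _ huv0 h3
  simp only [ω, Finset.mem_filter, Finset.mem_univ, true_and] at h1 h2 h3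
  rw [hadd, Pi.mul_apply, (hw u i).resolve_left h1, (hw v i).resolve_left h2] at h3
  simp at h3

theorem notMem_of_inter_eq_empty {α : Type*} [DecidableEq α] {A B C : Finset α}
    (h : A ∩ B ∩ C = ∅) (i : α) : i ∈ A → i ∈ B → i ∉ C := fun hA hB hC =>
  Finset.notMem_empty i (h ▸ by simp [hA, hB, hC])

/-! ### The cases s = 1, 2, 3. -/

theorem one_le_buchstaberInvariant_iff :
    1 ≤ buchstaberInvariant K ↔ ConditionS1 (minNonSimplices K) := by
  constructor
  · intro h
    obtain ⟨F, hF, -⟩ := exists_nonSimplices_of_le h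
    exact ⟨F 1, hF 1 (by decide)⟩
  · rintro ⟨τ, hτ⟩
    refine le_buchstaberInvariant_of_torusHom (fun _ _ => true) fun σ hσ t ht => ?_
    obtain ⟨i, -, hi⟩ := exists_mem_notMem_of_mem_minNonSimplices hτ hσ
    funext j
    have := ht i hi
    simpa [torusHom_apply, Subsingleton.elim j 0] using this

theorem two_le_buchstaberInvariant_iff :
    2 ≤ buchstaberInvariant K ↔ ConditionS2 (minNonSimplices K) := by
  constructor
  · intro h
    obtain ⟨F, hF, hline⟩ := exists_nonSimplices_of_le h
    exact conditionS2_of_line empty_notMem_minNonSimplices (hF ![1, 0] (by decide))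
      (hF ![0, 1] (by decide)) (hF (![1, 0] + ![0, 1]) (by decide))
      (hline _ _ (by decide) (by decide) (by decide))
  · intro h
    obtain ⟨A, hA, B, hB, C, hC, hABC⟩ := exists_line_of_conditionS2 h
    have key : ∀ b₁ b₂ b₃ : Bool, ¬ (b₁ ∧ b₂ ∧ b₃) →
        ∃ a : Fin 2 → Bool, (b₁ → a 0) ∧ (b₂ → a 1) ∧ (b₃ → (a 0 ^^ a 1)) := by
      decide
    have hrow : ∀ i : Fin m, ∃ a : Fin 2 → Bool,
        (i ∈ A → a 0) ∧ (i ∈ B → a 1) ∧ (i ∈ C → (a 0 ^^ a 1)) := by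
      intro i
      simpa using key (decide (i ∈ A)) (decide (i ∈ B)) (decide (i ∈ C))
        (by simpa using notMem_of_inter_eq_empty hABC i)
    choose a ha using hrow
    refine le_buchstaberInvariant_of_torusHom a fun σ hσ t ht => ?_
    obtain ⟨i, hiA, hi⟩ := exists_mem_notMem_of_mem_minNonSimplices hA hσ
    obtain ⟨j, hjB, hj⟩ := exists_mem_notMem_of_mem_minNonSimplices hB hσ
    obtain ⟨k, hkC, hk⟩ := exists_mem_notMem_of_mem_minNonSimplices hC hσ
    have h1 := ht i hi
    have h2 := ht j hj
    have h3 := ht k hk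
    simp only [torusHom_apply, Fin.prod_univ_two, (ha i).1 hiA, (ha j).2.1 hjB] at h1 h2 h3
    have h4 := (ha k).2.2 hkC
    -- `h3` says that `t 0` or `t 1` is trivial; then `h2` or `h1` gives the other.
    have : t 0 = 1 ∧ t 1 = 1 := by
      generalize t 0 = x at *
      generalize t 1 = y at *
      cases h : a i 1 <;> cases h' : a j 0 <;> cases h'' : a k 0 <;> cases h''' : a k 1 <;>
        simp_all
    funext l
    fin_cases l
    · exact this.1
    · exact this.2

/-- Among the seven squarefree monomials in three commuting elements, if the trivial ones are not
all orthogonal modulo 2 to a nonzero vector, then the three elements are trivial. -/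
theorem eq_one_of_squarefree_monomials {G : Type*} [CommGroup G] (p q r : G)
    (h₁ : p = 1 ∨ p * q = 1 ∨ p * r = 1 ∨ p * q * r = 1)
    (h₂ : q = 1 ∨ p * q = 1 ∨ q * r = 1 ∨ p * q * r = 1)
    (h₃ : r = 1 ∨ p * r = 1 ∨ q * r = 1 ∨ p * q * r = 1)
    (h₄ : p = 1 ∨ q = 1 ∨ p * r = 1 ∨ q * r = 1)
    (h₅ : p = 1 ∨ r = 1 ∨ p * q = 1 ∨ q * r = 1)
    (h₆ : q = 1 ∨ r = 1 ∨ p * q = 1 ∨ p * r = 1)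
    (h₇ : p = 1 ∨ q = 1 ∨ r = 1 ∨ p * q * r = 1) : p = 1 ∧ q = 1 ∧ r = 1 := by
  -- Six of the seven Fano lines are genuine product relations. The line `pq, pr, qr` is not, having
  -- determinant ±2.
  have key : ∀ a b c : G, c = a * b → (a = 1 → b = 1 → c = 1) ∧ (a = 1 → c = 1 → b = 1) ∧
      (b = 1 → c = 1 → a = 1) := by
    rintro a b c rfl
    refine ⟨fun h h' => by simp [h, h'], fun h h' => by simpa [h] using h',
      fun h h' => by simpa [h] using h'⟩
  have l₁ := key p q (p * q) rfl
  have l₂ := key p r (p * r) rfl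
  have l₃ := key q r (q * r) rfl
  have l₄ := key p (q * r) (p * q * r) (mul_assoc _ _ _)
  have l₅ := key q (p * r) (p * q * r) (by rw [mul_left_comm, mul_assoc])
  have l₆ := key (p * q) r (p * q * r) rfl
  grind

set_option synthInstance.maxSize 1000 in
set_option synthInstance.maxHeartbeats 200000 in
/-- A set of points of the Fano plane that contains no line lies in an affine plane that avoids the
origin. -/
theorem exists_dual_vector : ∀ b₁ b₂ b₃ b₄ b₅ b₆ b₇ : Bool,
    ¬ (b₁ ∧ b₂ ∧ b₄) → ¬ (b₁ ∧ b₃ ∧ b₅) → ¬ (b₁ ∧ b₆ ∧ b₇) → ¬ (b₂ ∧ b₃ ∧ b₆) →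
    ¬ (b₂ ∧ b₅ ∧ b₇) → ¬ (b₃ ∧ b₄ ∧ b₇) → ¬ (b₄ ∧ b₅ ∧ b₆) →
    ∃ x y z : Bool, (b₁ → x) ∧ (b₂ → y) ∧ (b₃ → z) ∧ (b₄ → (x ^^ y)) ∧ (b₅ → (x ^^ z)) ∧
      (b₆ → (y ^^ z)) ∧ (b₇ → (x ^^ (y ^^ z))) := by
  decide

/-- Each premise says that the exponent `(x, y, z)` pairs oddly with one nonzero vector; the
disjunction lists all monomials doing so, the given one among them. -/
theorem monomial_cases {G : Type*} [CommGroup G] (p q r : G) (x y z : Bool)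
    (h : (if x then p else 1) * (if y then q else 1) * (if z then r else 1) = 1) :
    (x → p = 1 ∨ p * q = 1 ∨ p * r = 1 ∨ p * q * r = 1) ∧
    (y → q = 1 ∨ p * q = 1 ∨ q * r = 1 ∨ p * q * r = 1) ∧
    (z → r = 1 ∨ p * r = 1 ∨ q * r = 1 ∨ p * q * r = 1) ∧
    ((x ^^ y) → p = 1 ∨ q = 1 ∨ p * r = 1 ∨ q * r = 1) ∧
    ((x ^^ z) → p = 1 ∨ r = 1 ∨ p * q = 1 ∨ q * r = 1) ∧
    ((y ^^ z) → q = 1 ∨ r = 1 ∨ p * q = 1 ∨ p * r = 1) ∧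
    ((x ^^ (y ^^ z)) → p = 1 ∨ q = 1 ∨ r = 1 ∨ p * q * r = 1) := by
  revert h
  cases x <;> cases y <;> cases z <;> simp +contextual

theorem three_le_buchstaberInvariant_iff :
    3 ≤ buchstaberInvariant K ↔ ConditionS3 (minNonSimplices K) := by
  constructor
  · intro h
    obtain ⟨F, hF, hline⟩ := exists_nonSimplices_of_le h
    exact conditionS3_of_fano empty_notMem_minNonSimplices F hF hline
  · intro h
    obtain ⟨A, B, C, D, E, F, G, hN, h124, h135, h167, h236, h257, h347, h456⟩ :=
      exists_fano_of_conditionS3 h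
    simp only [List.forall_mem_cons, List.not_mem_nil, false_imp_iff, implies_true,
      and_true] at hN
    obtain ⟨hA, hB, hC, hD, hE, hF, hG⟩ := hN
    have hrow : ∀ i : Fin m, ∃ x y z : Bool, (i ∈ A → x) ∧ (i ∈ B → y) ∧ (i ∈ C → z) ∧
        (i ∈ D → (x ^^ y)) ∧ (i ∈ E → (x ^^ z)) ∧ (i ∈ F → (y ^^ z)) ∧
        (i ∈ G → (x ^^ (y ^^ z))) := by
      intro i
      have key := exists_dual_vector (decide (i ∈ A)) (decide (i ∈ B)) (decide (i ∈ C))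
        (decide (i ∈ D)) (decide (i ∈ E)) (decide (i ∈ F)) (decide (i ∈ G))
      simp only [decide_eq_true_eq, not_and] at key
      exact key (notMem_of_inter_eq_empty h124 i) (notMem_of_inter_eq_empty h135 i)
        (notMem_of_inter_eq_empty h167 i) (notMem_of_inter_eq_empty h236 i)
        (notMem_of_inter_eq_empty h257 i) (notMem_of_inter_eq_empty h347 i)
        (notMem_of_inter_eq_empty h456 i)
    choose x y z ha using hrow
    refine le_buchstaberInvariant_of_torusHom (fun i => ![x i, y i, z i]) fun σ hσ t ht => ?_
    have hone : ∀ i, i ∉ σ → (if x i then t 0 else 1) * (if y i then t 1 else 1) *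
        (if z i then t 2 else 1) = 1 := by
      intro i hi
      have := ht i hi
      rwa [torusHom_apply, Fin.prod_univ_three] at this
    have point : ∀ τ ∈ minNonSimplices K, ∃ i ∈ τ, (if x i then t 0 else 1) *
        (if y i then t 1 else 1) * (if z i then t 2 else 1) = 1 := by
      intro τ hτ
      obtain ⟨i, hi, hiσ⟩ := exists_mem_notMem_of_mem_minNonSimplices hτ hσ
      exact ⟨i, hi, hone i hiσ⟩
    have ht1 : t 0 = 1 ∧ t 1 = 1 ∧ t 2 = 1 := by
      apply eq_one_of_squarefree_monomials
      · obtain ⟨i, hi, h⟩ := point A hA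
        exact (monomial_cases _ _ _ _ _ _ h).1 ((ha i).1 hi)
      · obtain ⟨i, hi, h⟩ := point B hB
        exact (monomial_cases _ _ _ _ _ _ h).2.1 ((ha i).2.1 hi)
      · obtain ⟨i, hi, h⟩ := point C hC
        exact (monomial_cases _ _ _ _ _ _ h).2.2.1 ((ha i).2.2.1 hi)
      · obtain ⟨i, hi, h⟩ := point D hD
        exact (monomial_cases _ _ _ _ _ _ h).2.2.2.1 ((ha i).2.2.2.1 hi)
      · obtain ⟨i, hi, h⟩ := point E hE
        exact (monomial_cases _ _ _ _ _ _ h).2.2.2.2.1 ((ha i).2.2.2.2.1 hi)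
      · obtain ⟨i, hi, h⟩ := point F hF
        exact (monomial_cases _ _ _ _ _ _ h).2.2.2.2.2.1 ((ha i).2.2.2.2.2.1 hi)
      · obtain ⟨i, hi, h⟩ := point G hG
        exact (monomial_cases _ _ _ _ _ _ h).2.2.2.2.2.2 ((ha i).2.2.2.2.2.2 hi)
    funext l
    fin_cases l
    · exact ht1.1
    · exact ht1.2.1
    · exact ht1.2.2

end Freeness
end BuchstaberInv

theorem mainTheorem1 (m : ℕ) (K : PreAbstractSimplicialComplex (Fin m)) :
    (1 ≤ BuchstaberInv.buchstaberInvariant K ↔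
      BuchstaberInv.ConditionS1 (BuchstaberInv.minNonSimplices K)) ∧
    (BuchstaberInv.ConditionS1 (BuchstaberInv.minNonSimplices K) ↔
      ¬ ∀ σ : Finset (Fin m), BuchstaberInv.IsSimplex K σ) ∧
    (2 ≤ BuchstaberInv.buchstaberInvariant K ↔
      BuchstaberInv.ConditionS2 (BuchstaberInv.minNonSimplices K)) ∧
    (3 ≤ BuchstaberInv.buchstaberInvariant K ↔
      BuchstaberInv.ConditionS3 (BuchstaberInv.minNonSimplices K)) :=
  ⟨BuchstaberInv.one_le_buchstaberInvariant_iff, BuchstaberInv.conditionS1_iff,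
    BuchstaberInv.two_le_buchstaberInvariant_iff, BuchstaberInv.three_le_buchstaberInvariant_iff⟩
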